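/- Let $d\ge 1$, $k\in\{1,\dots,d\}$ and $p\in[1,\infty)$, and let $\|\cdot\|$ be the Euclidean norm. Let $\mathscr P_p(\mathbb R^d)$ be the set of Borel probability measures $\mu$ on $\mathbb R^d$ with $M_p(\mu)=\int\|x\|^p\,d\mu(x)<\infty$. For probability measures $\mu,\nu$ on $\mathbb R^n$ put $$\mathcal W_p(\mu,\nu)=\Big(\inf_{\pi\in\Pi(\mu,\nu)}\int\|x-y\|^p\,d\pi(x,y)\Big)^{1/p},$$ where $\Pi(\mu,\nu)$ is the set of probability measures on $\mathbb R^n\times\mathbb R^n$ with marginals $\mu$ and $\nu$. Let $\mathbb S_{d,k}=\{E\in\mathbb R^{d\times k}:E^\top E=I_k\}$, let $\sigma$ be the uniform (i.e. $O(d)$-invariant) probability distribution on $\mathbb S_{d,k}$, and let $E^\star(x)=E^\top x$. The projection robust Wasserstein (PRW) and integrated projection robust Wasserstein (IPRW) distances of $\mu,\nu\in\mathscr P_p(\mathbb R^d)$ are $$\overline{\mathcal{PW}}_{p,k}(\mu,\nu)=\sup_{E\in\mathbb S_{d,k}}\mathcal W_p(E^\star_\#\mu,E^\star_\#\nu),\qquad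 \underline{\mathcal{PW}}_{p,k}(\mu,\nu)=\Big(\int_{\mathbb S_{d,k}}\mathcal W_p^p(E^\star_\#\mu,E^\star_\#\nu)\,d\sigma(E)\Big)^{1/p}.$$ Theorem. For every sequence $(\mu_i)_{i\in\mathbb N}$ in $\mathscr P_p(\mathbb R^d)$ and every $\mu\in\mathscr P_p(\mathbb R^d)$, the following are equivalent: 1. $\underline{\mathcal{PW}}_{p,k}(\mu_i,\mu)\to0$; 2. $\overline{\mathcal{PW}}_{p,k}(\mu_i,\mu)\to0$; 3. $\mathcal W_p(\mu_i,\mu)\to0$; 4. $\mu_i$ converges weakly to $\mu$ in $\mathscr P_p(\mathbb R^d)$, that is, $\int f\,d\mu_i\to\int f\,d\mu$ for every bounded continuous $f:\mathbb R^d\to\mathbb R$, and $M_p(\mu_i)\to M_p(\mu)$. In this sense the IPRW and PRW distances both metrize weak convergence in $\mathscr P_p(\mathbb R^d)$, as $\mathcal W_p$ does. -/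

import Mathlib

open MeasureTheory Filter Topology
open scoped ENNReal Matrix

namespace ProjectedTransport

noncomputable section

/-! ### The space of probability measures with finite moment of order `p` -/

/-- The moment `M_p(μ) = ∫ ‖x‖^p dμ(x)`, Euclidean norm, as an extended nonnegative number. -/
def moment {d : ℕ} (p : ℝ) (μ : Measure (EuclideanSpace ℝ (Fin d))) : ℝ≥0∞ :=
  ∫⁻ x, ‖x‖ₑ ^ p ∂μ

/-- `𝒫_p(ℝ^d)`: the Borel probability measures on `ℝ^d` with `M_p(μ) < ∞`. -/
def PSpace (p : ℝ) (d : ℕ) : Type :=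
  {μ : ProbabilityMeasure (EuclideanSpace ℝ (Fin d)) //
    moment p (μ : Measure (EuclideanSpace ℝ (Fin d))) < ∞}

/-- The measure underlying an element of `𝒫_p(ℝ^d)`. -/
def PSpace.toMeasure {p : ℝ} {d : ℕ} (μ : PSpace p d) : Measure (EuclideanSpace ℝ (Fin d)) :=
  (μ.1 : Measure (EuclideanSpace ℝ (Fin d)))

/-- Weak convergence `μ_i ⇒ μ` in `𝒫_p(ℝ^d)`: convergence of the integrals of all bounded
continuous functions (the topology of `ProbabilityMeasure`), and convergence of the moments of
order `p`. -/
def WeaklyConverges {p : ℝ} {d : ℕ} (μs : ℕ → PSpace p d) (μ : PSpace p d) : Prop :=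
  Tendsto (fun i => (μs i).1) atTop (𝓝 μ.1) ∧
    Tendsto (fun i => moment p (μs i).toMeasure) atTop (𝓝 (moment p μ.toMeasure))

/-! ### The Wasserstein distance -/

/-- `Π(μ, ν)`: the measures on the product whose marginals are `μ` and `ν`. For probability
measures `μ` and `ν` these are probability measures. -/
def couplings {n : ℕ} (μ ν : Measure (EuclideanSpace ℝ (Fin n))) :
    Set (Measure (EuclideanSpace ℝ (Fin n) × EuclideanSpace ℝ (Fin n))) :=
  {π | π.map Prod.fst = μ ∧ π.map Prod.snd = ν}

/-- The Wasserstein distance `W_p(μ, ν) = (inf_π ∫ ‖x - y‖^p dπ(x, y))^{1/p}` on `ℝ^n`. -/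
def wasserstein {n : ℕ} (p : ℝ) (μ ν : Measure (EuclideanSpace ℝ (Fin n))) : ℝ≥0∞ :=
  (⨅ π ∈ couplings μ ν, ∫⁻ z, ‖z.1 - z.2‖ₑ ^ p ∂π) ^ (1 / p)

/-! ### The Stiefel manifold and its uniform distribution -/

instance instMeasurableSpaceMatrix (m n : ℕ) : MeasurableSpace (Matrix (Fin m) (Fin n) ℝ) :=
  borel _

instance instBorelSpaceMatrix (m n : ℕ) : BorelSpace (Matrix (Fin m) (Fin n) ℝ) := ⟨rfl⟩

instance instCompactSpaceOrthogonalGroup (d : ℕ) :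
    CompactSpace (Matrix.orthogonalGroup (Fin d) ℝ) := by
  refine isCompact_iff_compactSpace.mp ?_
  have hK : IsCompact (Set.univ.pi fun _ : Fin d => Set.univ.pi fun _ : Fin d =>
      Set.Icc (-1 : ℝ) 1) :=
    isCompact_univ_pi fun _ => isCompact_univ_pi fun _ => isCompact_Icc
  have hC : IsClosed (unitary (Matrix (Fin d) (Fin d) ℝ) : Set (Matrix (Fin d) (Fin d) ℝ)) :=
    isClosed_unitary (R := Matrix (Fin d) (Fin d) ℝ)
  refine IsCompact.of_isClosed_subset hK hC ?_
  intro U hU i _ j _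
  have h := entry_norm_bound_of_unitary (𝕜 := ℝ) hU i j
  exact abs_le.mp h

/-- The Stiefel manifold `{E ∈ ℝ^{d × k} : Eᵀ E = I_k}`. -/
def stiefel (d k : ℕ) : Set (Matrix (Fin d) (Fin k) ℝ) := {E | Eᵀ * E = 1}

/-- The matrix formed by the first `k` columns of an orthogonal matrix. -/
def firstColumns {d k : ℕ} (hkd : k ≤ d) (U : Matrix.orthogonalGroup (Fin d) ℝ) : stiefel d k :=
  ⟨U.1.submatrix id (Fin.castLE hkd), by
    have hU : (U.1)ᵀ * U.1 = 1 := Matrix.mem_unitaryGroup_iff'.mp U.2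
    change (U.1.submatrix id (Fin.castLE hkd))ᵀ * U.1.submatrix id (Fin.castLE hkd) = 1
    have h := Matrix.submatrix_mul (U.1)ᵀ U.1 (Fin.castLE hkd) id (Fin.castLE hkd)
      Function.bijective_id
    rw [Matrix.transpose_submatrix, ← h, hU, Matrix.submatrix_one _ (Fin.castLE_injective hkd)]⟩

/-- The uniform distribution `σ` on the Stiefel manifold: the law of the first `k` columns of a
Haar distributed orthogonal matrix. -/
def stiefelUniform {d k : ℕ} (hkd : k ≤ d) : Measure (stiefel d k) :=
  (Measure.haarMeasure (⊤ : TopologicalSpace.PositiveCompacts (Matrix.orthogonalGroup (Fin d) ℝ))).map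
    (firstColumns hkd)

theorem continuous_firstColumns {d k : ℕ} (hkd : k ≤ d) :
    Continuous (firstColumns hkd : Matrix.orthogonalGroup (Fin d) ℝ → stiefel d k) :=
  Continuous.subtype_mk (continuous_subtype_val.matrix_submatrix _ _) _

instance isProbabilityMeasure_stiefelUniform {d k : ℕ} (hkd : k ≤ d) :
    IsProbabilityMeasure (stiefelUniform hkd) := by
  have : IsProbabilityMeasure (Measure.haarMeasure
      (⊤ : TopologicalSpace.PositiveCompacts (Matrix.orthogonalGroup (Fin d) ℝ))) :=
    ⟨Measure.haarMeasure_self⟩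
  exact Measure.isProbabilityMeasure_map (continuous_firstColumns hkd).measurable.aemeasurable

/-- Left multiplication by an orthogonal matrix on the Stiefel manifold. -/
def rotate {d k : ℕ} (V : Matrix.orthogonalGroup (Fin d) ℝ) (E : stiefel d k) : stiefel d k :=
  ⟨V.1 * E.1, by
    have hV : (V.1)ᵀ * V.1 = 1 := Matrix.mem_unitaryGroup_iff'.mp V.2
    have hE : (E.1)ᵀ * E.1 = 1 := E.2
    change (V.1 * E.1)ᵀ * (V.1 * E.1) = 1
    rw [Matrix.transpose_mul, Matrix.mul_assoc, ← Matrix.mul_assoc (V.1)ᵀ, hV, Matrix.one_mul, hE]⟩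

/-- The uniform distribution is invariant under the action of the orthogonal group. -/
theorem map_rotate_stiefelUniform {d k : ℕ} (hkd : k ≤ d) (V : Matrix.orthogonalGroup (Fin d) ℝ) :
    (stiefelUniform hkd).map (rotate V) = stiefelUniform hkd := by
  have hr : Continuous (rotate V : stiefel d k → stiefel d k) :=
    Continuous.subtype_mk (continuous_const.matrix_mul continuous_subtype_val) _
  have hf := (continuous_firstColumns hkd).measurable
  have hcomp : (rotate V ∘ firstColumns hkd : _ → stiefel d k) =
      firstColumns hkd ∘ (fun U => V * U) := by
    funext U
    apply Subtype.ext
    ext i j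
    rfl
  unfold stiefelUniform
  rw [Measure.map_map hr.measurable hf, hcomp,
    ← Measure.map_map hf (continuous_const_mul V).measurable, map_mul_left_eq_self]

/-- The linear map `E^⋆ : ℝ^d → ℝ^k`, `E^⋆(x) = Eᵀ x`. -/
def proj {d k : ℕ} (E : stiefel d k) : EuclideanSpace ℝ (Fin d) → EuclideanSpace ℝ (Fin k) :=
  fun x => WithLp.toLp 2 ((E.1)ᵀ *ᵥ x.ofLp)

/-! ### The projection robust Wasserstein distances -/

/-- The projection robust Wasserstein (PRW) distance
`sup_E W_p(E^⋆_# μ, E^⋆_# ν)`, over `E` in the Stiefel manifold. -/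
def PRW {d : ℕ} (p : ℝ) (k : ℕ) (μ ν : Measure (EuclideanSpace ℝ (Fin d))) : ℝ≥0∞ :=
  ⨆ E : stiefel d k, wasserstein p (μ.map (proj E)) (ν.map (proj E))

/-- The integrated projection robust Wasserstein (IPRW) distance
`(∫ W_p^p(E^⋆_# μ, E^⋆_# ν) dσ(E))^{1/p}`, with `σ` the uniform distribution on the Stiefel
manifold. -/
def IPRW {d k : ℕ} (p : ℝ) (hkd : k ≤ d) (μ ν : Measure (EuclideanSpace ℝ (Fin d))) : ℝ≥0∞ :=
  (∫⁻ E, wasserstein p (μ.map (proj E)) (ν.map (proj E)) ^ p ∂(stiefelUniform hkd)) ^ (1 / p)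

end

end ProjectedTransport

namespace ProjectedTransport

open scoped NNReal

/-! The cycle is 1 → 4 → 3 → 2 → 1. The steps 3 → 2 → 1 hold because `E^⋆` is 1-Lipschitz and `σ` is
a probability measure.

For 1 → 4, rotation invariance of `σ` gives `∫ ‖E^⋆ x‖^p dσ(E) = c ‖x‖^p` with `0 < c < ∞`, so
Minkowski in `L^p(σ)` bounds the difference of the values `(c M_p)^{1/p}` by the IPRW distance, and
the moments converge (`tendsto_moment_of_tendsto_IPRW`). The first moments are then eventually
bounded, so the characteristic functions are equi-Lipschitz. Every `v` equals `E t` for some `E`,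
and a gap between characteristic functions at `v` persists for all nearby `E`, a set of positive
`σ`-measure; there it bounds the projected Wasserstein distance from below
(`tendsto_charFun_of_tendsto_IPRW`). Lévy's continuity theorem concludes.

For 4 → 3, an explicit coupling matches small pieces of the two measures cut out by a partition of
unity and couples the rest arbitrarily; convergence of moments makes the rest cheap
(`eventually_wasserstein_rpow_lt`). -/

instance secondCountableTopology_matrix (m n : ℕ) :
    SecondCountableTopology (Matrix (Fin m) (Fin n) ℝ) :=
  inferInstanceAs (SecondCountableTopology (Fin m → Fin n → ℝ))

instance PSpace.isProbabilityMeasure_toMeasure {p : ℝ} {d : ℕ} (μ : PSpace p d) :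
    IsProbabilityMeasure μ.toMeasure :=
  inferInstanceAs (IsProbabilityMeasure (μ.1 : Measure (EuclideanSpace ℝ (Fin d))))

/-! ### Bounds valid for every coupling: moments and characteristic functions -/

section Wasserstein

variable {n : ℕ} {p : ℝ} {μ ν : Measure (EuclideanSpace ℝ (Fin n))}
  {π : Measure (EuclideanSpace ℝ (Fin n) × EuclideanSpace ℝ (Fin n))}

theorem wasserstein_le (hp : 1 ≤ p) (hπ : π ∈ couplings μ ν) :
    wasserstein p μ ν ≤ (∫⁻ z, ‖z.1 - z.2‖ₑ ^ p ∂π) ^ (1 / p) :=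
  ENNReal.rpow_le_rpow (iInf₂_le π hπ) (by positivity)

theorem le_wasserstein (hp : 1 ≤ p) {a : ℝ≥0∞}
    (h : ∀ π ∈ couplings μ ν, a ≤ (∫⁻ z, ‖z.1 - z.2‖ₑ ^ p ∂π) ^ (1 / p)) :
    a ≤ wasserstein p μ ν := by
  have hp0 : 0 < p := by linarith
  rw [wasserstein, one_div, ENNReal.le_rpow_inv_iff hp0]
  refine le_iInf₂ fun π hπ => ?_
  rw [← ENNReal.le_rpow_inv_iff hp0, ← one_div]
  exact h π hπ

theorem lintegral_fst_of_mem_couplings (hπ : π ∈ couplings μ ν)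
    {f : EuclideanSpace ℝ (Fin n) → ℝ≥0∞} (hf : Measurable f) :
    ∫⁻ z, f z.1 ∂π = ∫⁻ x, f x ∂μ := by
  rw [← hπ.1, lintegral_map hf measurable_fst]

theorem lintegral_snd_of_mem_couplings (hπ : π ∈ couplings μ ν)
    {f : EuclideanSpace ℝ (Fin n) → ℝ≥0∞} (hf : Measurable f) :
    ∫⁻ z, f z.2 ∂π = ∫⁻ x, f x ∂ν := by
  rw [← hπ.2, lintegral_map hf measurable_snd]

theorem isProbabilityMeasure_of_mem_couplings [IsProbabilityMeasure μ]
    (hπ : π ∈ couplings μ ν) : IsProbabilityMeasure π := by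
  refine ⟨?_⟩
  have h := congrArg (fun m => m Set.univ) hπ.1
  simpa [Measure.map_apply measurable_fst MeasurableSet.univ] using h

theorem measurable_enorm_rpow {p : ℝ} :
    Measurable fun x : EuclideanSpace ℝ (Fin n) => ‖x‖ₑ ^ p := by fun_prop

/-- Minkowski's inequality along couplings. -/
theorem moment_rpow_le_add_wasserstein (hp : 1 ≤ p) :
    moment p μ ^ (1 / p) ≤ moment p ν ^ (1 / p) + wasserstein p μ ν := by
  refine tsub_le_iff_left.mp (le_wasserstein hp fun π hπ => tsub_le_iff_left.mpr ?_)
  rw [moment, moment, ← lintegral_fst_of_mem_couplings hπ measurable_enorm_rpow,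
    ← lintegral_snd_of_mem_couplings hπ measurable_enorm_rpow]
  refine le_trans ?_ (ENNReal.lintegral_Lp_add_le (μ := π) (p := p)
    (f := fun z => ‖z.2‖ₑ) (g := fun z => ‖z.1 - z.2‖ₑ) (by fun_prop) (by fun_prop) hp)
  gcongr with z
  calc ‖z.1‖ₑ = ‖z.2 + (z.1 - z.2)‖ₑ := by congr 1; abel
    _ ≤ _ := enorm_add_le _ _

theorem moment_rpow_le_add_wasserstein' (hp : 1 ≤ p) :
    moment p ν ^ (1 / p) ≤ moment p μ ^ (1 / p) + wasserstein p μ ν := by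
  refine tsub_le_iff_left.mp (le_wasserstein hp fun π hπ => tsub_le_iff_left.mpr ?_)
  rw [moment, moment, ← lintegral_fst_of_mem_couplings hπ measurable_enorm_rpow,
    ← lintegral_snd_of_mem_couplings hπ measurable_enorm_rpow]
  refine le_trans ?_ (ENNReal.lintegral_Lp_add_le (μ := π) (p := p)
    (f := fun z => ‖z.1‖ₑ) (g := fun z => ‖z.1 - z.2‖ₑ) (by fun_prop) (by fun_prop) hp)
  gcongr with z
  calc ‖z.2‖ₑ = ‖z.1 - (z.1 - z.2)‖ₑ := by congr 1; abel
    _ ≤ _ := enorm_sub_le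

theorem lintegral_le_rpow {α : Type*} [MeasurableSpace α] {m : Measure α}
    [IsProbabilityMeasure m] (hp : 1 ≤ p) {f : α → ℝ≥0∞} (hf : AEMeasurable f m) :
    ∫⁻ a, f a ∂m ≤ (∫⁻ a, f a ^ p ∂m) ^ (1 / p) := by
  have h := eLpNorm'_le_eLpNorm'_of_exponent_le (f := f) (μ := m) zero_lt_one hp
    hf.aestronglyMeasurable
  simpa [eLpNorm'] using h

theorem enorm_exp_mul_I_sub_le (a b : ℝ) :
    ‖Complex.exp (a * Complex.I) - Complex.exp (b * Complex.I)‖ₑ ≤ ‖a - b‖ₑ := by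
  have h : Complex.exp (a * Complex.I) - Complex.exp (b * Complex.I) =
      Complex.exp (b * Complex.I) * (Complex.exp (Complex.I * ((a - b : ℝ) : ℂ)) - 1) := by
    rw [mul_sub, ← Complex.exp_add, mul_one]
    congr 2
    push_cast
    ring
  have h1 : ‖Complex.exp (b * Complex.I)‖ₑ = 1 := by
    rw [← ofReal_norm, Complex.norm_exp_ofReal_mul_I, ENNReal.ofReal_one]
  rw [h, enorm_mul, h1, one_mul]
  exact Real.enorm_exp_I_mul_ofReal_sub_one_le

theorem integrable_exp_inner_mul_I {α : Type*} [MeasurableSpace α] {m : Measure α}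
    [IsFiniteMeasure m] {f : α → ℝ} (hf : Measurable f) :
    Integrable (fun a => Complex.exp (f a * Complex.I)) m := by
  refine Integrable.of_bound (C := 1) (by fun_prop) (ae_of_all _ fun a => ?_)
  rw [Complex.norm_exp_ofReal_mul_I]

theorem enorm_inner_le (x y : EuclideanSpace ℝ (Fin n)) : ‖inner ℝ x y‖ₑ ≤ ‖x‖ₑ * ‖y‖ₑ := by
  rw [← ofReal_norm, ← ofReal_norm, ← ofReal_norm, ← ENNReal.ofReal_mul (norm_nonneg _)]
  exact ENNReal.ofReal_le_ofReal (norm_inner_le_norm x y)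

/-- The function `x ↦ exp(i⟨x, t⟩)` is `‖t‖`-Lipschitz, which bounds the gap by `‖t‖` times the
first-order cost of any coupling; that cost is at most the one of order `p`. -/
theorem enorm_charFun_sub_le_wasserstein [IsProbabilityMeasure μ] (hp : 1 ≤ p)
    (t : EuclideanSpace ℝ (Fin n)) :
    ‖charFun μ t - charFun ν t‖ₑ / ‖t‖ₑ ≤ wasserstein p μ ν := by
  refine le_wasserstein hp fun π hπ => ?_
  have : IsProbabilityMeasure π := isProbabilityMeasure_of_mem_couplings hπ
  refine le_trans ?_ (lintegral_le_rpow hp (by fun_prop))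
  refine ENNReal.div_le_of_le_mul ?_
  have h1 : charFun μ t = ∫ z, Complex.exp (inner ℝ z.1 t * Complex.I) ∂π := by
    rw [charFun_apply, ← hπ.1, integral_map measurable_fst.aemeasurable (by fun_prop)]
  have h2 : charFun ν t = ∫ z, Complex.exp (inner ℝ z.2 t * Complex.I) ∂π := by
    rw [charFun_apply, ← hπ.2, integral_map measurable_snd.aemeasurable (by fun_prop)]
  rw [h1, h2, ← integral_sub (integrable_exp_inner_mul_I (by fun_prop))
    (integrable_exp_inner_mul_I (by fun_prop)), ← lintegral_mul_const _ (by fun_prop)]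
  refine (enorm_integral_le_lintegral_enorm _).trans (lintegral_mono fun z => ?_)
  refine (enorm_exp_mul_I_sub_le _ _).trans ?_
  rw [← inner_sub_left]
  exact enorm_inner_le _ _

/-- A bound on first moments thus makes a family of characteristic functions equi-Lipschitz. -/
theorem enorm_charFun_sub_le_moment [IsProbabilityMeasure μ]
    (s t : EuclideanSpace ℝ (Fin n)) :
    ‖charFun μ s - charFun μ t‖ₑ ≤ (∫⁻ x, ‖x‖ₑ ∂μ) * ‖s - t‖ₑ := by
  rw [charFun_apply, charFun_apply, ← integral_sub (integrable_exp_inner_mul_I (by fun_prop))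
    (integrable_exp_inner_mul_I (by fun_prop)), ← lintegral_mul_const _ (by fun_prop)]
  refine (enorm_integral_le_lintegral_enorm _).trans (lintegral_mono fun z => ?_)
  refine (enorm_exp_mul_I_sub_le _ _).trans ?_
  rw [← inner_sub_right]
  exact enorm_inner_le _ _

end Wasserstein

/-! ### Projections and the comparison of the three distances -/

section Projection

variable {d k : ℕ} {p : ℝ}

/-- The adjoint `t ↦ E t` of the projection `E^⋆`. -/
noncomputable def incl (E : stiefel d k) (t : EuclideanSpace ℝ (Fin k)) :
    EuclideanSpace ℝ (Fin d) :=
  WithLp.toLp 2 (E.1 *ᵥ t.ofLp)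

theorem inner_proj_left (E : stiefel d k) (x : EuclideanSpace ℝ (Fin d))
    (t : EuclideanSpace ℝ (Fin k)) : inner ℝ (proj E x) t = inner ℝ x (incl E t) := by
  simp only [EuclideanSpace.inner_eq_star_dotProduct, proj, incl, star_trivial]
  rw [Matrix.mulVec_transpose, dotProduct_comm, ← Matrix.dotProduct_mulVec, dotProduct_comm]

theorem proj_incl (E : stiefel d k) (t : EuclideanSpace ℝ (Fin k)) : proj E (incl E t) = t := by
  have h : (E.1)ᵀ * E.1 = 1 := E.2
  simp [proj, incl, Matrix.mulVec_mulVec, h]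

theorem norm_incl (E : stiefel d k) (t : EuclideanSpace ℝ (Fin k)) : ‖incl E t‖ = ‖t‖ := by
  have h := inner_proj_left E (incl E t) t
  rw [proj_incl, real_inner_self_eq_norm_sq, real_inner_self_eq_norm_sq] at h
  exact ((sq_eq_sq₀ (norm_nonneg _) (norm_nonneg _)).mp h).symm

/-- Adjointness, Cauchy–Schwarz and the isometry `incl E` give `‖E^⋆ x‖² ≤ ‖x‖ ‖E^⋆ x‖`. -/
theorem norm_proj_le (E : stiefel d k) (x : EuclideanSpace ℝ (Fin d)) : ‖proj E x‖ ≤ ‖x‖ := by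
  have h := inner_proj_left E x (proj E x)
  rw [real_inner_self_eq_norm_sq] at h
  have h2 := real_inner_le_norm x (incl E (proj E x))
  rw [← h, norm_incl] at h2
  by_contra! hlt
  nlinarith [norm_nonneg x]

theorem proj_sub (E : stiefel d k) (x y : EuclideanSpace ℝ (Fin d)) :
    proj E (x - y) = proj E x - proj E y := by
  simp [proj, Matrix.mulVec_sub]

theorem proj_smul (E : stiefel d k) (c : ℝ) (x : EuclideanSpace ℝ (Fin d)) :
    proj E (c • x) = c • proj E x := by
  simp [proj, Matrix.mulVec_smul]

theorem continuous_proj_uncurry :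
    Continuous fun z : stiefel d k × EuclideanSpace ℝ (Fin d) => proj z.1 z.2 := by
  unfold proj
  refine (PiLp.continuous_toLp 2 _).comp ?_
  exact Continuous.matrix_mulVec (continuous_subtype_val.comp continuous_fst).matrix_transpose
    ((PiLp.continuous_ofLp 2 _).comp continuous_snd)

theorem continuous_proj (E : stiefel d k) : Continuous (proj E) :=
  continuous_proj_uncurry.comp (Continuous.prodMk_right E)

theorem continuous_proj_apply (x : EuclideanSpace ℝ (Fin d)) :
    Continuous fun E : stiefel d k => proj E x :=
  continuous_proj_uncurry.comp (Continuous.prodMk_left x)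

theorem continuous_incl_apply (t : EuclideanSpace ℝ (Fin k)) :
    Continuous fun E : stiefel d k => incl E t := by
  unfold incl
  exact (PiLp.continuous_toLp 2 _).comp
    (Continuous.matrix_mulVec continuous_subtype_val continuous_const)

theorem charFun_map_proj (E : stiefel d k) (μ : Measure (EuclideanSpace ℝ (Fin d)))
    (t : EuclideanSpace ℝ (Fin k)) : charFun (μ.map (proj E)) t = charFun μ (incl E t) := by
  rw [charFun_apply, charFun_apply,
    integral_map (continuous_proj E).measurable.aemeasurable (by fun_prop)]
  simp_rw [inner_proj_left]

/-- Pushing a coupling forward by `E^⋆ × E^⋆` couples the projections and does not increase the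
cost. -/
theorem wasserstein_map_proj_le (hp : 1 ≤ p) (E : stiefel d k)
    (μ ν : Measure (EuclideanSpace ℝ (Fin d))) :
    wasserstein p (μ.map (proj E)) (ν.map (proj E)) ≤ wasserstein p μ ν := by
  refine le_wasserstein hp fun π hπ => ?_
  have hE := (continuous_proj E).measurable
  have hm : Measurable (Prod.map (proj E) (proj E)) := hE.prodMap hE
  have hmem : π.map (Prod.map (proj E) (proj E)) ∈
      couplings (μ.map (proj E)) (ν.map (proj E)) := by
    constructor
    · rw [Measure.map_map measurable_fst hm, ← hπ.1, Measure.map_map hE measurable_fst]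
      rfl
    · rw [Measure.map_map measurable_snd hm, ← hπ.2, Measure.map_map hE measurable_snd]
      rfl
  refine (wasserstein_le hp hmem).trans ?_
  rw [lintegral_map (by fun_prop) hm]
  gcongr with z
  simp only [Prod.map_fst, Prod.map_snd, ← proj_sub]
  exact enorm_le_iff_norm_le.mpr (norm_proj_le E _)

theorem PRW_le_wasserstein (hp : 1 ≤ p) (μ ν : Measure (EuclideanSpace ℝ (Fin d))) :
    PRW p k μ ν ≤ wasserstein p μ ν :=
  iSup_le fun E => wasserstein_map_proj_le hp E μ ν

theorem IPRW_le_PRW (hp : 1 ≤ p) (hkd : k ≤ d) (μ ν : Measure (EuclideanSpace ℝ (Fin d))) :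
    IPRW p hkd μ ν ≤ PRW p k μ ν := by
  have hp0 : 0 < p := by linarith
  rw [IPRW, one_div, ENNReal.rpow_inv_le_iff hp0]
  calc _ ≤ ∫⁻ _, PRW p k μ ν ^ p ∂(stiefelUniform hkd) := by
        gcongr with E
        exact le_iSup (fun E : stiefel d k => wasserstein p (μ.map (proj E)) (ν.map (proj E))) E
    _ = _ := by simp

end Projection

/-! ### Rotation invariance and averages over the Stiefel manifold -/

section Orthogonal

variable {d k : ℕ}

theorem exists_orthogonal_mulVec_single_eq (hd : 0 < d) (v : EuclideanSpace ℝ (Fin d)) :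
    ∃ U : Matrix.orthogonalGroup (Fin d) ℝ, U.1 *ᵥ Pi.single ⟨0, hd⟩ ‖v‖ = v.ofLp := by
  rcases eq_or_ne v 0 with rfl | hv
  · exact ⟨1, by simp⟩
  let i₀ : Fin d := ⟨0, hd⟩
  let w : Fin d → EuclideanSpace ℝ (Fin d) := fun _ => ‖v‖⁻¹ • v
  have hn : ‖v‖ ≠ 0 := norm_ne_zero_iff.mpr hv
  -- Only the value of `w` at `i₀` matters: the unit vector `v / ‖v‖` is completed to an orthonormal
  -- basis, whose vectors are the columns of `U`.
  have hw : Orthonormal ℝ (({i₀} : Set (Fin d)).domRestrict w) := by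
    refine ⟨fun i => ?_, fun i j hij => (hij (Subsingleton.elim i j)).elim⟩
    simp [w, Set.domRestrict, norm_smul, hn]
  obtain ⟨b, hb⟩ := hw.exists_orthonormalBasis_extension_of_card_eq (by simp)
  have hb0 : b i₀ = ‖v‖⁻¹ • v := hb i₀ rfl
  refine ⟨⟨(EuclideanSpace.basisFun (Fin d) ℝ).toBasis.toMatrix b,
    (EuclideanSpace.basisFun (Fin d) ℝ).toMatrix_orthonormalBasis_mem_unitary b⟩, ?_⟩
  ext i
  rw [Matrix.mulVec_single]
  change b i₀ i * ‖v‖ = v i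
  rw [hb0]
  simp only [PiLp.smul_apply, smul_eq_mul]
  field_simp

theorem incl_firstColumns (hk : 0 < k) (hkd : k ≤ d) (U : Matrix.orthogonalGroup (Fin d) ℝ)
    (r : ℝ) : incl (firstColumns hkd U) (EuclideanSpace.single ⟨0, hk⟩ r) =
      WithLp.toLp 2 (U.1 *ᵥ Pi.single ⟨0, hk.trans_le hkd⟩ r) := by
  ext i
  simp [incl, firstColumns, Matrix.mulVec_single, mul_comm]

theorem exists_incl_firstColumns_eq (hk : 0 < k) (hkd : k ≤ d) (v : EuclideanSpace ℝ (Fin d)) :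
    ∃ (U : Matrix.orthogonalGroup (Fin d) ℝ) (t : EuclideanSpace ℝ (Fin k)),
      incl (firstColumns hkd U) t = v := by
  obtain ⟨U, hU⟩ := exists_orthogonal_mulVec_single_eq (hk.trans_le hkd) v
  exact ⟨U, _, (incl_firstColumns hk hkd U ‖v‖).trans (by rw [hU])⟩

/-- Haar measure charges nonempty open sets; the witness `U` makes the preimage of `O` nonempty. -/
theorem stiefelUniform_pos_of_isOpen (hkd : k ≤ d) {O : Set (stiefel d k)} (hO : IsOpen O)
    (U : Matrix.orthogonalGroup (Fin d) ℝ) (hU : firstColumns hkd U ∈ O) :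
    0 < stiefelUniform hkd O := by
  have hc := continuous_firstColumns hkd
  rw [stiefelUniform, Measure.map_apply hc.measurable hO.measurableSet]
  exact (hO.preimage hc).measure_pos _ ⟨U, hU⟩

/-- The projected energy `∫ ‖E^⋆ x‖^p dσ(E)` of a vector. -/
noncomputable def projEnergy (p : ℝ) (hkd : k ≤ d) (x : EuclideanSpace ℝ (Fin d)) : ℝ≥0∞ :=
  ∫⁻ E, ‖proj E x‖ₑ ^ p ∂(stiefelUniform hkd)

/-- Joint measurability, needed for Tonelli. -/
theorem measurable_enorm_proj_rpow (p : ℝ) :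
    Measurable fun z : stiefel d k × EuclideanSpace ℝ (Fin d) => ‖proj z.1 z.2‖ₑ ^ p :=
  (continuous_proj_uncurry.measurable.enorm).pow_const p

/-- Since `Eᵀ V = (V⁻¹ E)ᵀ`, a rotation of `x` is absorbed by the invariance of `σ`. -/
theorem projEnergy_rotate (p : ℝ) (hkd : k ≤ d) (V : Matrix.orthogonalGroup (Fin d) ℝ)
    (x : EuclideanSpace ℝ (Fin d)) :
    projEnergy p hkd (WithLp.toLp 2 (V.1 *ᵥ x.ofLp)) = projEnergy p hkd x := by
  have hr : Continuous (rotate V⁻¹ : stiefel d k → stiefel d k) :=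
    Continuous.subtype_mk (continuous_const.matrix_mul continuous_subtype_val) _
  conv_rhs => rw [projEnergy, ← map_rotate_stiefelUniform hkd V⁻¹]
  rw [lintegral_map ((continuous_proj_apply x).measurable.enorm.pow_const p) hr.measurable,
    projEnergy]
  refine lintegral_congr fun E => ?_
  congr 2
  have hV : (V⁻¹).1 = (V.1)ᵀ := rfl
  simp [proj, rotate, hV, Matrix.mulVec_mulVec, Matrix.transpose_mul]

theorem projEnergy_smul {p : ℝ} (hp : 0 ≤ p) (hkd : k ≤ d) (c : ℝ)
    (x : EuclideanSpace ℝ (Fin d)) :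
    projEnergy p hkd (c • x) = ‖c‖ₑ ^ p * projEnergy p hkd x := by
  simp_rw [projEnergy, proj_smul, enorm_smul, ENNReal.mul_rpow_of_nonneg _ _ hp]
  exact lintegral_const_mul _ ((continuous_proj_apply x).measurable.enorm.pow_const p)

theorem projEnergy_eq {p : ℝ} (hp : 0 ≤ p) (hd : 0 < d) (hkd : k ≤ d)
    (x : EuclideanSpace ℝ (Fin d)) :
    projEnergy p hkd x = projEnergy p hkd (EuclideanSpace.single ⟨0, hd⟩ 1) * ‖x‖ₑ ^ p := by
  obtain ⟨U, hU⟩ := exists_orthogonal_mulVec_single_eq hd x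
  have hx : x = WithLp.toLp 2 (U.1 *ᵥ
      (‖x‖ • EuclideanSpace.single (⟨0, hd⟩ : Fin d) (1 : ℝ)).ofLp) := by
    have h : (‖x‖ • EuclideanSpace.single (⟨0, hd⟩ : Fin d) (1 : ℝ)).ofLp =
        Pi.single ⟨0, hd⟩ ‖x‖ := by
      ext i
      simp [Pi.single_apply]
    rw [h, hU]
  conv_lhs => rw [hx]
  rw [projEnergy_rotate, projEnergy_smul hp, enorm_norm, mul_comm]

theorem projEnergy_le {p : ℝ} (hp : 0 ≤ p) (hkd : k ≤ d) (x : EuclideanSpace ℝ (Fin d)) :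
    projEnergy p hkd x ≤ ‖x‖ₑ ^ p := by
  calc _ ≤ ∫⁻ _, ‖x‖ₑ ^ p ∂(stiefelUniform hkd) := by
        unfold projEnergy
        gcongr with E
        exact enorm_le_iff_norm_le.mpr (norm_proj_le E x)
    _ = _ := by simp

/-- The integrand is nonzero on an open set containing the first `k` columns of the identity, since
`k ≥ 1`. -/
theorem projEnergy_single_ne_zero {p : ℝ} (hp : 0 < p) (hk : 0 < k) (hkd : k ≤ d) :
    projEnergy p hkd (EuclideanSpace.single ⟨0, hk.trans_le hkd⟩ 1) ≠ 0 := by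
  set e : EuclideanSpace ℝ (Fin d) := EuclideanSpace.single ⟨0, hk.trans_le hkd⟩ 1
  have hc := continuous_proj_apply (k := k) e
  rw [projEnergy, ← pos_iff_ne_zero,
    lintegral_pos_iff_support (hc.measurable.enorm.pow_const p)]
  refine lt_of_lt_of_le (stiefelUniform_pos_of_isOpen hkd
    (O := {E | proj E e ≠ 0}) (isOpen_ne_fun hc continuous_const) 1 ?_) (measure_mono ?_)
  · have h : incl (firstColumns hkd 1) (EuclideanSpace.single ⟨0, hk⟩ 1) = e := by
      rw [incl_firstColumns]
      ext i
      simp [e, Matrix.one_apply]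
    intro h0
    rw [← h, proj_incl] at h0
    simpa using congrArg norm h0
  · intro E hE
    simpa [Function.mem_support, hp, not_lt.mpr hp.le] using hE

theorem moment_map_proj (p : ℝ) (E : stiefel d k) (μ : Measure (EuclideanSpace ℝ (Fin d))) :
    moment p (μ.map (proj E)) = ∫⁻ x, ‖proj E x‖ₑ ^ p ∂μ :=
  lintegral_map measurable_enorm_rpow (continuous_proj E).measurable

theorem measurable_moment_map_proj (p : ℝ) (μ : Measure (EuclideanSpace ℝ (Fin d)))
    [SFinite μ] : Measurable fun E : stiefel d k => moment p (μ.map (proj E)) := by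
  simp_rw [moment_map_proj]
  exact (measurable_enorm_proj_rpow p).lintegral_prod_right'

theorem lintegral_moment_map_proj {p : ℝ} (hp : 0 ≤ p) (hd : 0 < d) (hkd : k ≤ d)
    (μ : Measure (EuclideanSpace ℝ (Fin d))) [SFinite μ] :
    ∫⁻ E, moment p (μ.map (proj E)) ∂(stiefelUniform hkd) =
      projEnergy p hkd (EuclideanSpace.single ⟨0, hd⟩ 1) * moment p μ := by
  simp_rw [moment_map_proj]
  rw [lintegral_lintegral_swap (measurable_enorm_proj_rpow p).aemeasurable, moment,
    ← lintegral_const_mul _ measurable_enorm_rpow]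
  exact lintegral_congr fun x => projEnergy_eq hp hd hkd x

end Orthogonal

/-! ### From IPRW convergence to weak convergence -/

section Convergence

variable {d k : ℕ} {p : ℝ}

/-- Minkowski's inequality in `L^p(σ)`, from a comparison of projected moments. -/
theorem projEnergy_mul_moment_rpow_le (hp : 1 ≤ p) (hd : 0 < d) (hkd : k ≤ d)
    (μ ν : Measure (EuclideanSpace ℝ (Fin d))) [SFinite μ] [SFinite ν]
    {w : stiefel d k → ℝ≥0∞}
    (h : ∀ E, moment p (μ.map (proj E)) ^ (1 / p) ≤
      moment p (ν.map (proj E)) ^ (1 / p) + w E) :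
    (projEnergy p hkd (EuclideanSpace.single ⟨0, hd⟩ 1) * moment p μ) ^ (1 / p) ≤
      (projEnergy p hkd (EuclideanSpace.single ⟨0, hd⟩ 1) * moment p ν) ^ (1 / p) +
        (∫⁻ E, w E ^ p ∂(stiefelUniform hkd)) ^ (1 / p) := by
  have hp0 : 0 < p := by linarith
  have hμ : Measurable fun E : stiefel d k => moment p (μ.map (proj E)) ^ (1 / p) :=
    (measurable_moment_map_proj p μ).pow_const _
  have hν : Measurable fun E : stiefel d k => moment p (ν.map (proj E)) ^ (1 / p) :=
    (measurable_moment_map_proj p ν).pow_const _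
  have hpow (a : ℝ≥0∞) : (a ^ (1 / p)) ^ p = a := by
    rw [one_div, ENNReal.rpow_inv_rpow hp0.ne']
  rw [← lintegral_moment_map_proj hp0.le hd hkd μ, ← lintegral_moment_map_proj hp0.le hd hkd ν]
  calc _ = (∫⁻ E, (moment p (μ.map (proj E)) ^ (1 / p)) ^ p ∂(stiefelUniform hkd)) ^ (1 / p) := by
        simp_rw [hpow]
    -- No measurability of `w` is available, so Minkowski is applied to the truncated difference of
    -- the moment terms, which is measurable and lies below `w`.
    _ ≤ (∫⁻ E, (moment p (ν.map (proj E)) ^ (1 / p) + (moment p (μ.map (proj E)) ^ (1 / p) -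
          moment p (ν.map (proj E)) ^ (1 / p))) ^ p ∂(stiefelUniform hkd)) ^ (1 / p) := by
        gcongr with E
        exact le_add_tsub
    _ ≤ _ := ENNReal.lintegral_Lp_add_le hν.aemeasurable (hμ.sub hν).aemeasurable hp
    _ ≤ _ := by
        simp_rw [hpow]
        gcongr with E
        exact tsub_le_iff_left.mpr (h E)

theorem tendsto_moment_of_tendsto_IPRW (hp : 1 ≤ p) (hk : 0 < k) (hkd : k ≤ d)
    {μs : ℕ → PSpace p d} {μ : PSpace p d}
    (h : Tendsto (fun i => IPRW p hkd (μs i).toMeasure μ.toMeasure) atTop (𝓝 0)) :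
    Tendsto (fun i => moment p (μs i).toMeasure) atTop (𝓝 (moment p μ.toMeasure)) := by
  have hp0 : 0 < p := by linarith
  have hd : 0 < d := hk.trans_le hkd
  set c := projEnergy p hkd (EuclideanSpace.single ⟨0, hd⟩ 1)
  have hc0 : c ≠ 0 := projEnergy_single_ne_zero hp0 hk hkd
  have hctop : c ≠ ∞ := by
    refine ne_top_of_le_ne_top ?_ (projEnergy_le hp0.le hkd _)
    simp
  have hle i := projEnergy_mul_moment_rpow_le hp hd hkd (μs i).toMeasure μ.toMeasure
    fun E => moment_rpow_le_add_wasserstein hp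
  have hge i := projEnergy_mul_moment_rpow_le hp hd hkd μ.toMeasure (μs i).toMeasure
    fun E => moment_rpow_le_add_wasserstein' hp
  have hfin : (c * moment p μ.toMeasure) ^ (1 / p) ≠ ∞ :=
    ENNReal.rpow_ne_top_of_nonneg (by positivity) (ENNReal.mul_ne_top hctop μ.2.ne)
  have hlim : Tendsto (fun i => (c * moment p (μs i).toMeasure) ^ (1 / p)) atTop
      (𝓝 ((c * moment p μ.toMeasure) ^ (1 / p))) := by
    refine tendsto_of_tendsto_of_tendsto_of_le_of_le ?_ ?_
      (g := fun i => (c * moment p μ.toMeasure) ^ (1 / p) -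
        IPRW p hkd (μs i).toMeasure μ.toMeasure)
      (h := fun i => (c * moment p μ.toMeasure) ^ (1 / p) +
        IPRW p hkd (μs i).toMeasure μ.toMeasure)
      (fun i => tsub_le_iff_right.mpr (hge i)) hle
    · simpa using ENNReal.Tendsto.sub (tendsto_const_nhds (x := (c * moment p μ.toMeasure) ^ (1 / p)))
        h (Or.inl hfin)
    · simpa using (tendsto_const_nhds (x := (c * moment p μ.toMeasure) ^ (1 / p))).add h
  have h2 := ENNReal.Tendsto.const_mul (a := c⁻¹)
    ((ENNReal.continuous_rpow_const (y := p)).continuousAt.tendsto.comp hlim)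
    (Or.inr (ENNReal.inv_ne_top.mpr hc0))
  simpa [Function.comp_def, ← mul_assoc, ENNReal.rpow_inv_rpow hp0.ne',
    ENNReal.inv_mul_cancel hc0 hctop] using h2

theorem lintegral_enorm_le_one_add_moment (hp : 1 ≤ p) (μ : Measure (EuclideanSpace ℝ (Fin d)))
    [IsProbabilityMeasure μ] : ∫⁻ x, ‖x‖ₑ ∂μ ≤ 1 + moment p μ := by
  calc _ ≤ ∫⁻ x, (1 + ‖x‖ₑ ^ p) ∂μ := by
        gcongr with x
        rcases le_total ‖x‖ₑ 1 with h | h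
        · exact h.trans le_self_add
        · refine le_add_left ?_
          simpa using ENNReal.rpow_le_rpow_of_exponent_le h hp
    _ = _ := by simp [lintegral_add_left measurable_const, moment]

theorem tendsto_charFun_of_tendsto_IPRW (hp : 1 ≤ p) (hk : 0 < k) (hkd : k ≤ d)
    {μs : ℕ → PSpace p d} {μ : PSpace p d}
    (h : Tendsto (fun i => IPRW p hkd (μs i).toMeasure μ.toMeasure) atTop (𝓝 0))
    (v : EuclideanSpace ℝ (Fin d)) :
    Tendsto (fun i => charFun (μs i).toMeasure v) atTop (𝓝 (charFun μ.toMeasure v)) := by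
  have hp0 : 0 < p := by linarith
  have hmom := tendsto_moment_of_tendsto_IPRW hp hk hkd h
  -- A common bound for the first moments: `‖x‖ ≤ 1 + ‖x‖^p`, and the moments of order `p`
  -- eventually lie below `M_p(μ) + 1`.
  set K : ℝ≥0∞ := 1 + (moment p μ.toMeasure + 1) with hK
  have hμtop : moment p μ.toMeasure ≠ ∞ := μ.2.ne
  have hKtop : K ≠ ∞ := by simp [hK, hμtop]
  have hbd : ∀ᶠ i in atTop, ∫⁻ x, ‖x‖ₑ ∂(μs i).toMeasure ≤ K := by
    have := hmom.eventually_lt_const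
      (ENNReal.lt_add_right hμtop (one_ne_zero))
    filter_upwards [this] with i hi
    exact (lintegral_enorm_le_one_add_moment hp _).trans (add_le_add_right hi.le 1)
  have hbd' : ∫⁻ x, ‖x‖ₑ ∂μ.toMeasure ≤ K :=
    (lintegral_enorm_le_one_add_moment hp _).trans (add_le_add_right le_self_add 1)
  obtain ⟨U, t, hUt⟩ := exists_incl_firstColumns_eq hk hkd v
  rw [tendsto_iff_edist_tendsto_0, ENNReal.tendsto_nhds_zero]
  intro ε hε
  wlog hεtop : ε ≠ ∞ generalizing ε
  · push Not at hεtop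
    simp [hεtop]
  have hε4 : 0 < ε / 2 / 2 :=
    ENNReal.div_pos (ENNReal.div_pos hε.ne' (by simp)).ne' (by simp)
  -- near `v` the characteristic functions vary by at most `ε / 2 / 2`
  set δ : ℝ≥0∞ := ε / 2 / 2 / K with hδ
  have hδ0 : 0 < δ := ENNReal.div_pos hε4.ne' hKtop
  let O : Set (stiefel d k) := {E | ‖incl E t - v‖ₑ < δ}
  have hO : IsOpen O := isOpen_lt
    ((continuous_incl_apply t).sub continuous_const).enorm continuous_const
  have hs : 0 < stiefelUniform hkd O :=
    stiefelUniform_pos_of_isOpen hkd hO U (by simp [O, hUt, hδ0])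
  set s := stiefelUniform hkd O
  set T : ℝ≥0∞ := ‖t‖ₑ + 1
  have hT0 : T ≠ 0 := by simp [T]
  have hTtop : T ≠ ∞ := by simp [T]
  -- The IPRW value forced by a gap above `ε` at `v`: for `E` in `O` the gap at `incl E t` is still
  -- at least `ε / 4`, so the projected distance is at least `ε / 4 / T`, on a set of measure `s`.
  have hpos : 0 < ((ε / 2 / 2 / T) ^ p * s) ^ (1 / p) := by
    have h1 : 0 < ε / 2 / 2 / T := ENNReal.div_pos hε4.ne' hTtop
    refine ENNReal.rpow_pos_of_nonneg (ENNReal.mul_pos ?_ hs.ne') (by positivity)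
    exact (ENNReal.rpow_pos_of_nonneg h1 hp0.le).ne'
  filter_upwards [hbd, h.eventually_lt_const hpos] with i hi hI
  by_contra! hlt
  refine absurd hI (not_lt.mpr ?_)
  refine ENNReal.rpow_le_rpow ?_ (by positivity)
  have hδK : K * δ ≤ ε / 2 / 2 := by
    rw [hδ]
    exact ENNReal.mul_div_le
  rw [← setLIntegral_const]
  refine (setLIntegral_mono' hO.measurableSet fun E hE => ?_).trans (setLIntegral_le_lintegral _ _)
  refine ENNReal.rpow_le_rpow ?_ hp0.le
  have hE' : ‖incl E t - v‖ₑ ≤ δ := le_of_lt hE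
  have := Measure.isProbabilityMeasure_map (μ := (μs i).toMeasure)
    (continuous_proj E).measurable.aemeasurable
  have hW := enorm_charFun_sub_le_wasserstein (μ := (μs i).toMeasure.map (proj E))
    (ν := μ.toMeasure.map (proj E)) hp t
  rw [charFun_map_proj, charFun_map_proj] at hW
  refine le_trans (ENNReal.div_le_div ?_ le_self_add) hW
  by_contra! hb
  have h1 : edist (charFun (μs i).toMeasure v) (charFun (μs i).toMeasure (incl E t))
      ≤ ε / 2 / 2 := by
    rw [edist_comm, edist_eq_enorm_sub]
    exact (enorm_charFun_sub_le_moment _ _).trans ((mul_le_mul' hi hE').trans hδK)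
  have h2 : edist (charFun μ.toMeasure (incl E t)) (charFun μ.toMeasure v) ≤ ε / 2 / 2 := by
    rw [edist_eq_enorm_sub]
    exact (enorm_charFun_sub_le_moment _ _).trans ((mul_le_mul' hbd' hE').trans hδK)
  rw [← edist_eq_enorm_sub] at hb
  refine absurd hlt (not_lt.mpr ?_)
  calc _ ≤ _ := edist_triangle4 _ (charFun (μs i).toMeasure (incl E t))
        (charFun μ.toMeasure (incl E t)) _
    _ ≤ ε / 2 / 2 + ε / 2 / 2 + ε / 2 := by gcongr; exact h2.trans ENNReal.half_le_self
    _ = ε := by rw [ENNReal.add_halves, ENNReal.add_halves]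

theorem weaklyConverges_of_tendsto_IPRW (hp : 1 ≤ p) (hk : 0 < k) (hkd : k ≤ d)
    {μs : ℕ → PSpace p d} {μ : PSpace p d}
    (h : Tendsto (fun i => IPRW p hkd (μs i).toMeasure μ.toMeasure) atTop (𝓝 0)) :
    WeaklyConverges μs μ :=
  ⟨ProbabilityMeasure.tendsto_of_tendsto_charFun (tendsto_charFun_of_tendsto_IPRW hp hk hkd h),
    tendsto_moment_of_tendsto_IPRW hp hk hkd h⟩

end Convergence

/-! ### Assembling couplings from pieces -/

section Coupling

variable {n : ℕ} {p : ℝ} {μ ν : Measure (EuclideanSpace ℝ (Fin n))}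
  {π : Measure (EuclideanSpace ℝ (Fin n) × EuclideanSpace ℝ (Fin n))}

theorem add_mem_couplings {μ' ν' : Measure (EuclideanSpace ℝ (Fin n))}
    {π' : Measure (EuclideanSpace ℝ (Fin n) × EuclideanSpace ℝ (Fin n))}
    (hπ : π ∈ couplings μ ν) (hπ' : π' ∈ couplings μ' ν') :
    π + π' ∈ couplings (μ + μ') (ν + ν') :=
  ⟨by rw [Measure.map_add _ _ measurable_fst, hπ.1, hπ'.1],
    by rw [Measure.map_add _ _ measurable_snd, hπ.2, hπ'.2]⟩

theorem sum_mem_couplings {ι : Type*} [Fintype ι]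
    {μ ν : ι → Measure (EuclideanSpace ℝ (Fin n))}
    {π : ι → Measure (EuclideanSpace ℝ (Fin n) × EuclideanSpace ℝ (Fin n))}
    (hπ : ∀ j, π j ∈ couplings (μ j) (ν j)) : ∑ j, π j ∈ couplings (∑ j, μ j) (∑ j, ν j) := by
  constructor
  · rw [Measure.map_finset_sum measurable_fst.aemeasurable]
    exact Finset.sum_congr rfl fun j _ => (hπ j).1
  · rw [Measure.map_finset_sum measurable_snd.aemeasurable]
    exact Finset.sum_congr rfl fun j _ => (hπ j).2

theorem smul_prod_mem_couplings [IsFiniteMeasure μ] [IsFiniteMeasure ν]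
    (h : μ Set.univ = ν Set.univ) : (μ Set.univ)⁻¹ • μ.prod ν ∈ couplings μ ν := by
  -- For zero mass the scalar is `∞`, but it multiplies the zero measure.
  rcases eq_or_ne (μ Set.univ) 0 with h0 | h0
  · have hμ : μ = 0 := Measure.measure_univ_eq_zero.mp h0
    have hν : ν = 0 := Measure.measure_univ_eq_zero.mp (h ▸ h0)
    subst hμ hν
    simp [couplings]
  · constructor
    · rw [Measure.map_smul, Measure.map_fst_prod, smul_smul, ← h,
        ENNReal.inv_mul_cancel h0 (measure_ne_top _ _), one_smul]
    · rw [Measure.map_smul, Measure.map_snd_prod, smul_smul,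
        ENNReal.inv_mul_cancel h0 (measure_ne_top _ _), one_smul]

theorem measure_univ_of_mem_couplings (hπ : π ∈ couplings μ ν) :
    π Set.univ = μ Set.univ := by
  rw [← hπ.1, Measure.map_apply measurable_fst MeasurableSet.univ, Set.preimage_univ]

theorem lintegral_cost_le_moment (hp : 1 ≤ p) (hπ : π ∈ couplings μ ν) :
    ∫⁻ z, ‖z.1 - z.2‖ₑ ^ p ∂π ≤ 2 ^ (p - 1) * (moment p μ + moment p ν) := by
  rw [moment, moment, ← lintegral_fst_of_mem_couplings hπ measurable_enorm_rpow,
    ← lintegral_snd_of_mem_couplings hπ measurable_enorm_rpow,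
    ← lintegral_add_left (by fun_prop), ← lintegral_const_mul _ (by fun_prop)]
  gcongr with z
  exact (ENNReal.rpow_le_rpow enorm_sub_le (by linarith)).trans
    (ENNReal.rpow_add_le_mul_rpow_add_rpow _ _ hp)

theorem lintegral_cost_le_of_ae (hp : 1 ≤ p) (hπ : π ∈ couplings μ ν)
    {s t : Set (EuclideanSpace ℝ (Fin n))} {r : ℝ≥0∞} (hs : ∀ᵐ x ∂μ, x ∈ s)
    (ht : ∀ᵐ x ∂ν, x ∈ t) (hst : ∀ x ∈ s, ∀ y ∈ t, ‖x - y‖ₑ ≤ r) :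
    ∫⁻ z, ‖z.1 - z.2‖ₑ ^ p ∂π ≤ r ^ p * μ Set.univ := by
  rw [← hπ.1] at hs
  rw [← hπ.2] at ht
  rw [← measure_univ_of_mem_couplings hπ, ← lintegral_const]
  refine lintegral_mono_ae ?_
  filter_upwards [ae_of_ae_map measurable_fst.aemeasurable hs,
    ae_of_ae_map measurable_snd.aemeasurable ht] with z h1 h2
  exact ENNReal.rpow_le_rpow (hst _ h1 _ h2) (by linarith)

theorem sum_withDensity_add_withDensity_one_sub {α ι : Type*} [MeasurableSpace α] [Fintype ι]
    (μ : Measure α) {g : ι → α → ℝ≥0∞} (hg : ∀ j, Measurable (g j))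
    (hg1 : ∀ x, ∑ j, g j x ≤ 1) :
    ∑ j, μ.withDensity (g j) + μ.withDensity (fun x => 1 - ∑ j, g j x) = μ := by
  ext s hs
  rw [Measure.add_apply, Measure.coe_finsetSum, Finset.sum_apply]
  simp_rw [withDensity_apply _ hs]
  rw [← lintegral_finsetSum _ fun j _ => hg j,
    ← lintegral_add_left (Finset.measurable_fun_sum _ fun j _ => hg j)]
  simp_rw [add_tsub_cancel_of_le (hg1 _)]
  simp

/-- Transport cost of coupling matching pieces of two measures and the two remainders. -/
theorem wasserstein_rpow_le_of_density [IsProbabilityMeasure μ] [IsProbabilityMeasure ν]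
    (hp : 1 ≤ p) {ι : Type*} [Fintype ι] {g h : ι → EuclideanSpace ℝ (Fin n) → ℝ≥0∞}
    (hg : ∀ j, Measurable (g j)) (hh : ∀ j, Measurable (h j))
    (hg1 : ∀ x, ∑ j, g j x ≤ 1) (hh1 : ∀ x, ∑ j, h j x ≤ 1)
    (hmass : ∀ j, ∫⁻ x, g j x ∂μ = ∫⁻ x, h j x ∂ν) {r : ℝ≥0∞}
    (hr : ∀ j x y, g j x ≠ 0 → h j y ≠ 0 → ‖x - y‖ₑ ≤ r) :
    wasserstein p μ ν ^ p ≤ r ^ p + 2 ^ (p - 1) *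
      (∫⁻ x, (1 - ∑ j, g j x) * ‖x‖ₑ ^ p ∂μ + ∫⁻ x, (1 - ∑ j, h j x) * ‖x‖ₑ ^ p ∂ν) := by
  have hp0 : 0 < p := by linarith
  have hgs : Measurable fun x => 1 - ∑ j, g j x :=
    measurable_const.sub (Finset.measurable_fun_sum _ fun j _ => hg j)
  have hhs : Measurable fun x => 1 - ∑ j, h j x :=
    measurable_const.sub (Finset.measurable_fun_sum _ fun j _ => hh j)
  set ρ := μ.withDensity fun x => 1 - ∑ j, g j x with hρ
  set τ := ν.withDensity fun x => 1 - ∑ j, h j x with hτ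
  have hμ : ∑ j, μ.withDensity (g j) + ρ = μ := sum_withDensity_add_withDensity_one_sub μ hg hg1
  have hν : ∑ j, ν.withDensity (h j) + τ = ν := sum_withDensity_add_withDensity_one_sub ν hh hh1
  have hle {m : Measure (EuclideanSpace ℝ (Fin n))} [IsProbabilityMeasure m]
      {f : EuclideanSpace ℝ (Fin n) → ℝ≥0∞} (hf : ∀ x, f x ≤ 1) :
      IsFiniteMeasure (m.withDensity f) := by
    refine isFiniteMeasure_withDensity (ne_top_of_le_ne_top ENNReal.one_ne_top ?_)
    simpa using lintegral_mono (μ := m) hf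
  have : IsFiniteMeasure ρ := hle fun x => tsub_le_self
  have : IsFiniteMeasure τ := hle fun x => tsub_le_self
  have (j : ι) : IsFiniteMeasure (μ.withDensity (g j)) := hle fun x =>
    (Finset.single_le_sum (f := fun j => g j x) (fun _ _ => zero_le) (Finset.mem_univ j)).trans
      (hg1 x)
  have (j : ι) : IsFiniteMeasure (ν.withDensity (h j)) := hle fun x =>
    (Finset.single_le_sum (f := fun j => h j x) (fun _ _ => zero_le) (Finset.mem_univ j)).trans
      (hh1 x)
  have hm (j : ι) : μ.withDensity (g j) Set.univ = ν.withDensity (h j) Set.univ := by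
    simpa [withDensity_apply] using hmass j
  have hμu := congrArg (fun m => m Set.univ) hμ
  have hνu := congrArg (fun m => m Set.univ) hν
  simp only [Measure.add_apply, Measure.coe_finsetSum, Finset.sum_apply, measure_univ]
    at hμu hνu
  have hρτ : ρ Set.univ = τ Set.univ := by
    simp_rw [hm] at hμu
    refine (ENNReal.add_right_inj ?_).mp (hμu.trans hνu.symm)
    exact ENNReal.sum_ne_top.mpr fun j _ => measure_ne_top _ _
  have hπ1 := fun j => smul_prod_mem_couplings (hm j)
  have hπ2 := smul_prod_mem_couplings hρτ
  have hπ := add_mem_couplings (sum_mem_couplings hπ1) hπ2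
  rw [hμ, hν] at hπ
  have hW := wasserstein_le hp hπ
  rw [one_div, ENNReal.le_rpow_inv_iff hp0] at hW
  refine hW.trans ?_
  rw [lintegral_add_measure, lintegral_finsetSum_measure]
  refine add_le_add ?_ ?_
  -- Matched pieces move mass by at most `r`, and their total mass is at most 1; the remainders
  -- below get the crude moment bound.
  · calc _ ≤ ∑ j, r ^ p * μ.withDensity (g j) Set.univ := by
          refine Finset.sum_le_sum fun j _ => lintegral_cost_le_of_ae hp (hπ1 j)
            (s := {x | g j x ≠ 0}) (t := {x | h j x ≠ 0}) ?_ ?_ fun x hx y hy => hr j x y hx hy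
          · exact (ae_withDensity_iff (hg j)).mpr (ae_of_all _ fun x hx => hx)
          · exact (ae_withDensity_iff (hh j)).mpr (ae_of_all _ fun x hx => hx)
      _ ≤ r ^ p * 1 := by
          rw [← Finset.mul_sum]
          gcongr
          exact le_of_le_of_eq le_self_add hμu
      _ = r ^ p := mul_one _
  · refine (lintegral_cost_le_moment hp hπ2).trans_eq ?_
    rw [moment, moment, hρ, hτ, lintegral_withDensity_eq_lintegral_mul _ hgs (by fun_prop),
      lintegral_withDensity_eq_lintegral_mul _ hhs (by fun_prop)]
    rfl

end Coupling

/-! ### Partitions of unity, tails and limits -/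

section WeakConvergence

variable {d : ℕ} {p : ℝ}

/-- A partition of unity on the closed ball of radius `R`, subordinate to finitely many balls of
radius `r / 2`. The bound `C` on the supports makes `f j x * ‖x‖ ^ p` an admissible test function
for weak convergence. -/
theorem exists_fine_partition (R : ℝ) {r : ℝ} (hr : 0 < r) :
    ∃ (ι : Type) (_ : Fintype ι) (f : ι → EuclideanSpace ℝ (Fin d) → ℝ≥0),
      (∀ j, Continuous (f j)) ∧ (∀ x, ∑ j, f j x ≤ 1) ∧ (∀ x, ‖x‖ ≤ R → ∑ j, f j x = 1) ∧
      (∀ j x y, f j x ≠ 0 → f j y ≠ 0 → ‖x - y‖ ≤ r) ∧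
      (∃ C : ℝ≥0, ∀ j x, f j x ≠ 0 → ‖x‖₊ ≤ C) := by
  obtain ⟨t, hts, htf, htc⟩ := (isCompact_closedBall (0 : EuclideanSpace ℝ (Fin d))
    R).finite_cover_balls (half_pos hr)
  obtain ⟨N, c, hc⟩ : ∃ (N : ℕ) (c : Fin N → EuclideanSpace ℝ (Fin d)), Set.range c = t := by
    have := htf.fintype
    exact ⟨_, fun i => ((Fintype.equivFin t).symm i).1, by
      ext x
      simp only [Set.mem_range]
      exact ⟨fun ⟨i, hi⟩ => hi ▸ ((Fintype.equivFin t).symm i).2,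
        fun hx => ⟨Fintype.equivFin t ⟨x, hx⟩, by simp⟩⟩⟩
  obtain ⟨f, hf⟩ := PartitionOfUnity.exists_isSubordinate
    (Metric.isClosed_closedBall (x := (0 : EuclideanSpace ℝ (Fin d))) (ε := R))
    (fun j : Fin N => Metric.ball (c j) (r / 2)) (fun _ => Metric.isOpen_ball)
    (by rw [← hc] at htc; simpa using htc)
  have hnn j x : 0 ≤ f j x := f.nonneg j x
  have hmem j x (h : (f j x).toNNReal ≠ 0) : dist x (c j) < r / 2 := by
    refine Metric.mem_ball.mp (hf j (subset_tsupport _ ?_))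
    rw [Function.mem_support]
    intro h0
    simp [h0] at h
  have hsum x : ((∑ j, (f j x).toNNReal : ℝ≥0) : ℝ) = ∑ᶠ j, f j x := by
    rw [finsum_eq_sum_of_fintype]
    push_cast
    exact Finset.sum_congr rfl fun j _ => Real.coe_toNNReal _ (hnn j x)
  refine ⟨Fin N, inferInstance, fun j x => (f j x).toNNReal,
    fun j => continuous_real_toNNReal.comp (f j).continuous, fun x => ?_, fun x hx => ?_,
    fun j x y hx hy => ?_, ∑ j, ‖c j‖₊ + (r / 2).toNNReal, fun j x hx => ?_⟩
  · rw [← NNReal.coe_le_coe, hsum]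
    exact f.sum_le_one x
  · rw [← NNReal.coe_inj, hsum]
    exact f.sum_eq_one (by simpa using hx)
  · rw [← dist_eq_norm]
    linarith [dist_triangle_right x y (c j), hmem j x hx, hmem j y hy]
  · have h1 : ‖x‖ ≤ ‖c j‖ + r / 2 := by
      have h2 := hmem j x hx
      rw [dist_eq_norm] at h2
      linarith [norm_le_norm_add_norm_sub' x (c j)]
    have h3 : ‖c j‖₊ ≤ ∑ j, ‖c j‖₊ :=
      Finset.single_le_sum (f := fun j => ‖c j‖₊) (fun _ _ => zero_le) (Finset.mem_univ j)
    rw [← NNReal.coe_le_coe] at h3 ⊢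
    rw [NNReal.coe_add, Real.coe_toNNReal _ (half_pos hr).le]
    exact h1.trans (add_le_add_left h3 _)

theorem tendsto_lintegral_of_tendsto {Ω : Type*} [MeasurableSpace Ω] [TopologicalSpace Ω]
    [OpensMeasurableSpace Ω] {μs : ℕ → ProbabilityMeasure Ω} {μ : ProbabilityMeasure Ω}
    (h : Tendsto μs atTop (𝓝 μ)) {g : Ω → ℝ≥0} (hg : Continuous g) (C : ℝ≥0)
    (hC : ∀ x, g x ≤ C) :
    Tendsto (fun i => ∫⁻ x, g x ∂(μs i : Measure Ω)) atTop
      (𝓝 (∫⁻ x, g x ∂(μ : Measure Ω))) := by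
  refine ProbabilityMeasure.tendsto_iff_forall_lintegral_tendsto.mp h
    (BoundedContinuousFunction.mkOfBound ⟨g, hg⟩ C fun x y => ?_)
  rw [ContinuousMap.coe_mk, NNReal.dist_eq]
  have hx : (g x : ℝ) ≤ C := hC x
  have hy : (g y : ℝ) ≤ C := hC y
  exact abs_sub_le_iff.mpr ⟨by linarith [(g y).coe_nonneg], by linarith [(g x).coe_nonneg]⟩

/-- The sets `{N < ‖x‖}` decrease to `∅`; absolute continuity of the finite integral `M_p(μ)` does
the rest. -/
theorem exists_setLIntegral_compl_closedBall_lt (μ : PSpace p d) {η : ℝ≥0∞} (hη : 0 < η) :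
    ∃ R : ℝ, ∫⁻ x in {x | R < ‖x‖}, ‖x‖ₑ ^ p ∂μ.toMeasure < η := by
  have h0 : Tendsto (μ.toMeasure ∘ fun N : ℕ => {x : EuclideanSpace ℝ (Fin d) | (N : ℝ) < ‖x‖})
      atTop (𝓝 0) := by
    have h := tendsto_measure_iInter_atTop (μ := μ.toMeasure)
      (s := fun N : ℕ => {x : EuclideanSpace ℝ (Fin d) | (N : ℝ) < ‖x‖})
      (fun N => (measurableSet_lt measurable_const measurable_norm).nullMeasurableSet)
      (fun M N hMN x (hx : (N : ℝ) < ‖x‖) => lt_of_le_of_lt (Nat.cast_le.mpr hMN) hx)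
      ⟨0, measure_ne_top _ _⟩
    have he : ⋂ N : ℕ, {x : EuclideanSpace ℝ (Fin d) | (N : ℝ) < ‖x‖} = ∅ := by
      refine Set.eq_empty_of_forall_notMem fun x hx => ?_
      obtain ⟨N, hN⟩ := exists_nat_ge ‖x‖
      exact absurd (Set.mem_iInter.mp hx N) (not_lt.mpr hN)
    rwa [he, measure_empty] at h
  obtain ⟨N, hN⟩ :=
    ((tendsto_setLIntegral_zero (f := fun x => ‖x‖ₑ ^ p) μ.2.ne h0).eventually_lt_const hη).exists
  exact ⟨N, hN⟩

theorem lintegral_one_sub_sum_mul {α ι : Type*} [MeasurableSpace α] [Fintype ι] {m : Measure α}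
    {g : ι → α → ℝ≥0∞} {u : α → ℝ≥0∞} (hg : ∀ j, Measurable (g j)) (hu : Measurable u)
    (hu_top : ∀ x, u x ≠ ∞) (hg1 : ∀ x, ∑ j, g j x ≤ 1) (hfin : ∫⁻ x, u x ∂m ≠ ∞) :
    ∫⁻ x, (1 - ∑ j, g j x) * u x ∂m = ∫⁻ x, u x ∂m - ∑ j, ∫⁻ x, g j x * u x ∂m := by
  have hgu j : Measurable fun x => g j x * u x := (hg j).mul hu
  have hle x : ∑ j, g j x * u x ≤ u x := by
    rw [← Finset.sum_mul]
    exact mul_le_of_le_one_left (zero_le) (hg1 x)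
  rw [← lintegral_finsetSum _ fun j _ => hgu j,
    ← lintegral_sub (Finset.measurable_fun_sum _ fun j _ => hgu j)
      (ne_top_of_le_ne_top hfin (lintegral_mono hle)) (ae_of_all _ hle)]
  refine lintegral_congr fun x => ?_
  rw [ENNReal.sub_mul fun _ _ => hu_top x, one_mul, Finset.sum_mul]

theorem tendsto_div_max {a : ℕ → ℝ≥0∞} {b : ℝ≥0∞} (ha : Tendsto a atTop (𝓝 b)) (hb0 : b ≠ 0)
    (hb : b ≠ ∞) : Tendsto (fun i => a i / max (a i) b) atTop (𝓝 1) ∧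
      Tendsto (fun i => b / max (a i) b) atTop (𝓝 1) := by
  have hmax : Tendsto (fun i => max (a i) b) atTop (𝓝 b) := by
    simpa using ha.max (tendsto_const_nhds (x := b))
  rw [← ENNReal.div_self hb0 hb]
  exact ⟨ENNReal.Tendsto.div ha (Or.inl hb0) hmax (Or.inl hb),
    ENNReal.Tendsto.div tendsto_const_nhds (Or.inl hb0) hmax (Or.inl hb)⟩

end WeakConvergence

/-! ### From weak convergence to Wasserstein convergence -/

section WeakToWasserstein

variable {d k : ℕ} {p : ℝ}

/-- Piece `j` has mass `a i j` under `μs i` and `b j` under `μ`. Scaling by `b / max(a, b)` and `a /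
max(a, b)` respectively gives both mass `min(a, b)`, so they can be matched at distance at most `r`.
The moments of both remainders tend to the part of `M_p(μ)` missed by the partition, which is below
`η`. -/
theorem eventually_wasserstein_rpow_lt (hp : 1 ≤ p) {μs : ℕ → PSpace p d} {μ : PSpace p d}
    (hconv : WeaklyConverges μs μ) {r : ℝ} (hr : 0 < r) {η : ℝ≥0∞} (hη : 0 < η) {ε : ℝ≥0∞}
    (hε : ENNReal.ofReal r ^ p + 2 ^ (p - 1) * (η + η) < ε) :
    ∀ᶠ i in atTop, wasserstein p (μs i).toMeasure μ.toMeasure ^ p < ε := by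
  have hp0 : 0 < p := by linarith
  obtain ⟨R, hR⟩ := exists_setLIntegral_compl_closedBall_lt μ hη
  obtain ⟨ι, _, f, hf, hf1, hfR, hfr, C, hC⟩ := exists_fine_partition (d := d) R hr
  have hf1' x : ∑ j, (f j x : ℝ≥0∞) ≤ 1 := by exact_mod_cast hf1 x
  have hfle j x : f j x ≤ 1 :=
    (Finset.single_le_sum (f := fun j => f j x) (fun _ _ => zero_le) (Finset.mem_univ j)).trans
      (hf1 x)
  have hfm j : Measurable fun x => (f j x : ℝ≥0∞) := (hf j).measurable.coe_nnreal_ennreal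
  set a : ℕ → ι → ℝ≥0∞ := fun i j => ∫⁻ x, f j x ∂(μs i).toMeasure
  set b : ι → ℝ≥0∞ := fun j => ∫⁻ x, f j x ∂μ.toMeasure
  set m : ℕ → ι → ℝ≥0∞ := fun i j => ∫⁻ x, f j x * ‖x‖ₑ ^ p ∂(μs i).toMeasure
  set q : ι → ℝ≥0∞ := fun j => ∫⁻ x, f j x * ‖x‖ₑ ^ p ∂μ.toMeasure
  have hab j : Tendsto (fun i => a i j) atTop (𝓝 (b j)) :=
    tendsto_lintegral_of_tendsto hconv.1 (hf j) 1 (hfle j)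
  have hmq j : Tendsto (fun i => m i j) atTop (𝓝 (q j)) := by
    have h := tendsto_lintegral_of_tendsto hconv.1 (g := fun x => f j x * ‖x‖₊ ^ p)
      ((hf j).mul ((NNReal.continuous_rpow_const hp0.le).comp continuous_nnnorm)) (C ^ p)
      fun x => by
        rcases eq_or_ne (f j x) 0 with h0 | h0
        · simp [h0]
        · exact (mul_le_of_le_one_left zero_le (hfle j x)).trans
            (NNReal.rpow_le_rpow (hC j x h0) hp0.le)
    simp only [ENNReal.coe_mul, ENNReal.coe_rpow_of_nonneg _ hp0.le] at h
    exact h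
  have hbtop j : b j ≠ ∞ := by
    refine ne_top_of_le_ne_top ENNReal.one_ne_top (b := 1) ?_
    simpa using lintegral_mono (μ := μ.toMeasure) fun x => ENNReal.coe_le_coe.mpr (hfle j x)
  -- Where `b j = 0` the matched fractions need not tend to 1, but such a piece carries no moment in
  -- the limit.
  have hq0 j (h0 : b j = 0) : q j = 0 := by
    have h1 := (lintegral_eq_zero_iff (hfm j)).mp h0
    refine (lintegral_eq_zero_iff ((hfm j).mul measurable_enorm_rpow)).mpr ?_
    filter_upwards [h1] with x hx
    exact mul_eq_zero_of_left hx _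
  -- the fractions of the pieces that are matched with each other
  set c : ℕ → ι → ℝ≥0∞ := fun i j => b j / max (a i j) (b j) with hc
  set e : ℕ → ι → ℝ≥0∞ := fun i j => a i j / max (a i j) (b j)
  have hc1 i j : c i j ≤ 1 := ENNReal.div_le_of_le_mul (by simp)
  have he1 i j : e i j ≤ 1 := ENNReal.div_le_of_le_mul (by simp)
  have hcm j : Tendsto (fun i => c i j * m i j) atTop (𝓝 (q j)) := by
    rcases eq_or_ne (b j) 0 with h0 | h0
    · simp [hc, h0, hq0 j h0]
    · simpa using ENNReal.Tendsto.mul (tendsto_div_max (hab j) h0 (hbtop j)).2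
        (Or.inl one_ne_zero) (hmq j) (Or.inr ENNReal.one_ne_top)
  have heq j : Tendsto (fun i => e i j * q j) atTop (𝓝 (q j)) := by
    rcases eq_or_ne (b j) 0 with h0 | h0
    · simp [hq0 j h0]
    · simpa using ENNReal.Tendsto.mul_const (b := q j)
        (tendsto_div_max (hab j) h0 (hbtop j)).1 (Or.inl one_ne_zero)
  have hw1 {w : ι → ℝ≥0∞} (hw : ∀ j, w j ≤ 1) x : ∑ j, w j * (f j x : ℝ≥0∞) ≤ 1 :=
    (Finset.sum_le_sum fun j _ => mul_le_of_le_one_left zero_le (hw j)).trans (hf1' x)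
  have hrem {w : ι → ℝ≥0∞} (hw : ∀ j, w j ≤ 1) (ν : PSpace p d) :
      ∫⁻ x, (1 - ∑ j, w j * (f j x : ℝ≥0∞)) * ‖x‖ₑ ^ p ∂ν.toMeasure =
        moment p ν.toMeasure - ∑ j, w j * ∫⁻ x, f j x * ‖x‖ₑ ^ p ∂ν.toMeasure := by
    rw [lintegral_one_sub_sum_mul (m := ν.toMeasure) (g := fun j x => w j * (f j x : ℝ≥0∞))
      (fun j => (hfm j).const_mul _) measurable_enorm_rpow (fun x => by simp [hp0.le])
      (hw1 hw) ν.2.ne]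
    refine congrArg₂ (· - ·) rfl (Finset.sum_congr rfl fun j _ => ?_)
    simp_rw [mul_assoc]
    exact lintegral_const_mul _ ((hfm j).mul measurable_enorm_rpow)
  have hbound i : wasserstein p (μs i).toMeasure μ.toMeasure ^ p ≤ ENNReal.ofReal r ^ p +
      2 ^ (p - 1) * ((moment p (μs i).toMeasure - ∑ j, c i j * m i j) +
        (moment p μ.toMeasure - ∑ j, e i j * q j)) := by
    rw [← hrem (hc1 i), ← hrem (he1 i)]
    refine wasserstein_rpow_le_of_density hp (g := fun j x => c i j * f j x)
      (h := fun j x => e i j * f j x) (fun j => (hfm j).const_mul _)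
      (fun j => (hfm j).const_mul _) (hw1 (hc1 i)) (hw1 (he1 i)) (fun j => ?_)
      fun j x y hx hy => ?_
    · rw [lintegral_const_mul _ (hfm j), lintegral_const_mul _ (hfm j)]
      change b j / _ * a i j = a i j / _ * b j
      rw [div_eq_mul_inv, div_eq_mul_inv]
      ring
    · rw [← ofReal_norm]
      refine ENNReal.ofReal_le_ofReal (hfr j x y ?_ ?_)
      · exact_mod_cast right_ne_zero_of_mul hx
      · exact_mod_cast right_ne_zero_of_mul hy
  -- The partition sums to 1 on the ball of radius `R`, so only the tail of `μ` is missed.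
  have hL : moment p μ.toMeasure - ∑ j, q j < η := by
    have h := hrem (w := fun _ => 1) (fun _ => le_rfl) μ
    simp only [one_mul] at h
    rw [← h]
    refine lt_of_le_of_lt ?_ hR
    rw [← lintegral_indicator (measurableSet_lt measurable_const measurable_norm)]
    refine lintegral_mono fun x => ?_
    by_cases hx : R < ‖x‖
    · rw [Set.indicator_of_mem (s := {x | R < ‖x‖}) hx]
      exact mul_le_of_le_one_left zero_le tsub_le_self
    · have h1 : ∑ j, (f j x : ℝ≥0∞) = 1 := by exact_mod_cast hfR x (not_lt.mp hx)
      simp [h1]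
  -- Convergence of the full moments enters here: together with that of the bounded pieces it
  -- prevents any moment from escaping to infinity.
  have hlim := ENNReal.Tendsto.const_mul (a := (2 : ℝ≥0∞) ^ (p - 1))
    ((ENNReal.Tendsto.sub hconv.2 (tendsto_finsetSum Finset.univ fun j _ => hcm j)
      (Or.inl μ.2.ne)).add
    (ENNReal.Tendsto.sub (tendsto_const_nhds (x := moment p μ.toMeasure))
      (tendsto_finsetSum Finset.univ fun j _ => heq j) (Or.inl μ.2.ne)))
    (Or.inr (ENNReal.rpow_ne_top_of_nonneg (by linarith) (by simp)))
  have hlim' := (tendsto_const_nhds (x := ENNReal.ofReal r ^ p)).add hlim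
  have hlt : ENNReal.ofReal r ^ p + 2 ^ (p - 1) * ((moment p μ.toMeasure - ∑ j, q j) +
      (moment p μ.toMeasure - ∑ j, q j)) < ε := by
    refine lt_of_le_of_lt ?_ hε
    gcongr
  filter_upwards [hlim'.eventually_lt_const hlt] with i hi
  exact (hbound i).trans_lt hi

theorem tendsto_wasserstein_of_weaklyConverges (hp : 1 ≤ p) {μs : ℕ → PSpace p d}
    {μ : PSpace p d} (hconv : WeaklyConverges μs μ) :
    Tendsto (fun i => wasserstein p (μs i).toMeasure μ.toMeasure) atTop (𝓝 0) := by
  have hp0 : 0 < p := by linarith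
  have h : Tendsto (fun i => wasserstein p (μs i).toMeasure μ.toMeasure ^ p) atTop (𝓝 0) := by
    rw [ENNReal.tendsto_nhds_zero]
    intro ε hε
    wlog hεtop : ε ≠ ∞ generalizing ε
    · push Not at hεtop
      simp [hεtop]
    have hε2 : 0 < ε / 2 := ENNReal.half_pos hε.ne'
    have h2top : (2 : ℝ≥0∞) ^ (p - 1) ≠ ∞ :=
      ENNReal.rpow_ne_top_of_nonneg (by linarith) (by simp)
    have hr : Tendsto (fun r : ℝ => ENNReal.ofReal r ^ p) (𝓝[>] 0) (𝓝 0) := by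
      have hc : Continuous fun r : ℝ => ENNReal.ofReal r ^ p :=
        (ENNReal.continuous_rpow_const (y := p)).comp ENNReal.continuous_ofReal
      simpa [hp0] using (hc.tendsto 0).mono_left nhdsWithin_le_nhds
    obtain ⟨r, hrε, hr0⟩ :=
      ((hr.eventually_lt_const hε2).and eventually_mem_nhdsWithin).exists
    -- With this value as `η`, the remainder term `2 ^ (p - 1) * (η + η)` is at most `ε / 2`.
    have hη : 0 < ε / 2 / 2 ^ (p - 1) / 2 :=
      ENNReal.half_pos (ENNReal.div_pos hε2.ne' h2top).ne'
    refine (eventually_wasserstein_rpow_lt hp hconv hr0 hη ?_).mono fun i hi => le_of_lt hi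
    rw [ENNReal.add_halves]
    calc _ < ε / 2 + ε / 2 := ENNReal.add_lt_add_of_lt_of_le
          (ne_top_of_le_ne_top (ENNReal.div_ne_top hεtop two_ne_zero) ENNReal.mul_div_le)
          hrε ENNReal.mul_div_le
      _ = ε := ENNReal.add_halves ε
  have h2 := (ENNReal.continuous_rpow_const (y := p⁻¹)).continuousAt.tendsto.comp h
  simpa [Function.comp_def, ENNReal.rpow_rpow_inv hp0.ne', hp0] using h2

end WeakToWasserstein

end ProjectedTransport

theorem mainTheorem10 (d k : ℕ) (hk : 1 ≤ k) (hkd : k ≤ d) (p : ℝ) (hp : 1 ≤ p)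
    (μs : ℕ → ProjectedTransport.PSpace p d) (μ : ProjectedTransport.PSpace p d) :
    List.TFAE [
      Tendsto (fun i => ProjectedTransport.IPRW p hkd (μs i).toMeasure μ.toMeasure) atTop (𝓝 0),
      Tendsto (fun i => ProjectedTransport.PRW p k (μs i).toMeasure μ.toMeasure) atTop (𝓝 0),
      Tendsto (fun i => ProjectedTransport.wasserstein p (μs i).toMeasure μ.toMeasure)
        atTop (𝓝 0),
      ProjectedTransport.WeaklyConverges μs μ] := by
  tfae_have 1 → 4 := ProjectedTransport.weaklyConverges_of_tendsto_IPRW hp hk hkd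
  tfae_have 4 → 3 := ProjectedTransport.tendsto_wasserstein_of_weaklyConverges hp
  tfae_have 3 → 2 := fun h => tendsto_of_tendsto_of_tendsto_of_le_of_le tendsto_const_nhds h
    (fun _ => zero_le) fun _ => ProjectedTransport.PRW_le_wasserstein hp _ _
  tfae_have 2 → 1 := fun h => tendsto_of_tendsto_of_tendsto_of_le_of_le tendsto_const_nhds h
    (fun _ => zero_le) fun _ => ProjectedTransport.IPRW_le_PRW hp hkd _ _
  tfae_finish
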